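/- Let $d,p\in\mathbb N$, let $\mu$ be a Borel probability measure on $\mathbb R^d$, let $F:\mathbb R^d\to\mathbb R^p$ and $\alpha\ge 0$. Assume that $F$ is continuous and $\sup_{x}\|F(x)\|(1+\|x\|^\alpha)^{-1}<+\infty$. Let $\mathcal P_\alpha$ be the set of Borel probability measures $\pi$ on $\mathbb R^d$ with $\int\|x\|^\alpha\,d\pi(x)<+\infty$, let $\mathcal P_\alpha^F=\{\pi\in\mathcal P_\alpha:\pi(F)=0\}$, where $\pi(F)=\int F\,d\pi$, and let $\mathrm{KL}(\pi|\mu)\in[0,+\infty]$ be the relative entropy. Consider the problem (P) minimize $\mathrm{KL}(\pi|\mu)$ subject to $\pi\in\mathcal P_\alpha^F$, with value $v(\mathrm P)=\inf_{\pi\in\mathcal P_\alpha^F}\mathrm{KL}(\pi|\mu)$, and, with $\Theta_F=\{\theta\in\mathbb R^p:\int\exp[-\langle\theta,F\rangle]\,d\mu<+\infty\}$, the problem (Q) maximize $\inf_{\pi\in\mathcal P_\alpha}\{\mathrm{KL}(\pi|\mu)+\langle\theta,\pi(F)\rangle\}$ subject to $\theta\in\Theta_F$, with value $v(\mathrm Q)=\sup_{\theta\in\Theta_F}\inf_{\pi\in\mathcal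 P_\alpha}\{\mathrm{KL}(\pi|\mu)+\langle\theta,\pi(F)\rangle\}$. For $\theta\in\mathbb R^p$ and a Borel set $N\subset\mathbb R^d$, say that (G) holds for $(\theta,N)$ if $\pi(N)=0$ for every $\pi\in\mathcal P_\alpha^F$ with $\mathrm{KL}(\pi|\mu)<+\infty$, if $\int_{\mathbb R^d\setminus N}\exp[-\langle\theta,F\rangle]\,d\mu<+\infty$, and if (P) has exactly one solution, namely the measure whose density with respect to $\mu$ is $$x\mapsto \exp[-\langle\theta,F(x)\rangle]\Big/\int_{\mathbb R^d\setminus N}\exp[-\langle\theta,F(y)\rangle]\,d\mu(y)\ \text{ if } x\notin N,\qquad 0\ \text{ if } x\in N.$$ (a) Suppose that (P) has a solution and $v(\mathrm P)<+\infty$. Then there exist $\theta^*\in\mathbb R^p$ and a Borel set $N$ such that (G) holds for $(\theta^*,N)$. If, moreover, there exists $\pi\in\mathcal P_\alpha^F$ with $\mathrm{KL}(\pi|\mu)<+\infty$ and $\mu\ll\pi$, then for every $(\theta^*,N)$ for which (G) holds, $\theta^*$ is a solution of (Q), the measure $\pi_{\theta^*}$ with density $\exp[-\langle\theta^*,F\rangle]/\int\exp[-\langle\theta^*,F\rangle]\,d\mu$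 with respect to $\mu$ is a solution of (P), and $v(\mathrm Q)=v(\mathrm P)$. (b) Let $\alpha'>\alpha$ and assume that $\int\exp[\eta\|x\|^{\alpha'}]\,d\mu(x)<+\infty$ for some $\eta>0$. Then the following are equivalent: (i) $v(\mathrm P)<+\infty$ and (P) has a solution of the above form, i.e. (G) holds for some $(\theta^*,N)$; (ii) there exists $\pi\in\mathcal P_\alpha^F$ with $\mathrm{KL}(\pi|\mu)<+\infty$. -/

import Mathlib

open MeasureTheory InformationTheory
open scoped ENNReal

noncomputable section

namespace MaxEnt

variable {d p : ℕ}

/-- Regularity and growth of the features: `F` is continuous and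
`‖F x‖ / (1 + ‖x‖ ^ α)` is bounded over `x`. -/
def A1 (F : EuclideanSpace ℝ (Fin d) → EuclideanSpace ℝ (Fin p)) (α : ℝ) : Prop :=
  Continuous F ∧ ∃ C : ℝ, 0 ≤ C ∧ ∀ x, ‖F x‖ * (1 + ‖x‖ ^ α)⁻¹ ≤ C

/-- Exponential moment of the reference measure: `∫ exp (η ‖x‖ ^ β) dμ < ∞` for some `η > 0`. -/
def A2 (μ : Measure (EuclideanSpace ℝ (Fin d))) (β : ℝ) : Prop :=
  ∃ η : ℝ, 0 < η ∧ Integrable (fun x => Real.exp (η * ‖x‖ ^ β)) μ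

/-- The set `𝒫_α` of Borel probability measures on `ℝᵈ` with a finite moment of order `α`. -/
def probMoment (d : ℕ) (α : ℝ) : Set (Measure (EuclideanSpace ℝ (Fin d))) :=
  {π | IsProbabilityMeasure π ∧ Integrable (fun x => ‖x‖ ^ α) π}

/-- The set `𝒫_α^F` of admissible probability measures: those `π ∈ 𝒫_α` with `π(F) = 0`. -/
def admissible (F : EuclideanSpace ℝ (Fin d) → EuclideanSpace ℝ (Fin p)) (α : ℝ) :
    Set (Measure (EuclideanSpace ℝ (Fin d))) :=
  {π | π ∈ probMoment d α ∧ Integrable F π ∧ ∫ x, F x ∂π = 0}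

/-- The value `v(P)` of the primal problem: the infimum of `KL(π | μ)` over admissible `π`. -/
def primalValue (μ : Measure (EuclideanSpace ℝ (Fin d)))
    (F : EuclideanSpace ℝ (Fin d) → EuclideanSpace ℝ (Fin p)) (α : ℝ) : ℝ≥0∞ :=
  ⨅ π ∈ admissible F α, klDiv π μ

/-- `π` is a solution of the primal problem (P). -/
def IsPrimalSolution (μ : Measure (EuclideanSpace ℝ (Fin d)))
    (F : EuclideanSpace ℝ (Fin d) → EuclideanSpace ℝ (Fin p)) (α : ℝ)
    (π : Measure (EuclideanSpace ℝ (Fin d))) : Prop :=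
  π ∈ admissible F α ∧ ∀ π' ∈ admissible F α, klDiv π μ ≤ klDiv π' μ

/-- The set `Θ_F` of parameters `θ` with `∫ exp (-⟨θ, F⟩) dμ < ∞`. -/
def parameterSet (μ : Measure (EuclideanSpace ℝ (Fin d)))
    (F : EuclideanSpace ℝ (Fin d) → EuclideanSpace ℝ (Fin p)) :
    Set (EuclideanSpace ℝ (Fin p)) :=
  {θ | Integrable (fun x => Real.exp (-(inner ℝ θ (F x)))) μ}

/-- The dual functional `θ ↦ inf {KL(π | μ) + ⟨θ, π(F)⟩ : π ∈ 𝒫_α}`. -/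
def dualFunction (μ : Measure (EuclideanSpace ℝ (Fin d)))
    (F : EuclideanSpace ℝ (Fin d) → EuclideanSpace ℝ (Fin p)) (α : ℝ)
    (θ : EuclideanSpace ℝ (Fin p)) : EReal :=
  ⨅ π ∈ probMoment d α, ((klDiv π μ : EReal) + ((inner ℝ θ (∫ x, F x ∂π) : ℝ) : EReal))

/-- The value `v(Q)` of the dual problem: the supremum of the dual functional over `Θ_F`. -/
def dualValue (μ : Measure (EuclideanSpace ℝ (Fin d)))
    (F : EuclideanSpace ℝ (Fin d) → EuclideanSpace ℝ (Fin p)) (α : ℝ) : EReal :=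
  ⨆ θ ∈ parameterSet μ F, dualFunction μ F α θ

/-- `θ` is a solution of the dual problem (Q). -/
def IsDualSolution (μ : Measure (EuclideanSpace ℝ (Fin d)))
    (F : EuclideanSpace ℝ (Fin d) → EuclideanSpace ℝ (Fin p)) (α : ℝ)
    (θ : EuclideanSpace ℝ (Fin p)) : Prop :=
  θ ∈ parameterSet μ F ∧
    ∀ θ' ∈ parameterSet μ F, dualFunction μ F α θ' ≤ dualFunction μ F α θ

/-- The log-partition function `L(θ) = log ∫ exp (-⟨θ, F⟩) dμ`. -/
def logPartition (μ : Measure (EuclideanSpace ℝ (Fin d)))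
    (F : EuclideanSpace ℝ (Fin d) → EuclideanSpace ℝ (Fin p))
    (θ : EuclideanSpace ℝ (Fin p)) : ℝ :=
  Real.log (∫ x, Real.exp (-(inner ℝ θ (F x))) ∂μ)

/-- The Gibbs measure `π_θ`, with density `exp (-⟨θ, F⟩ - L(θ))` with respect to `μ`. -/
def gibbs (μ : Measure (EuclideanSpace ℝ (Fin d)))
    (F : EuclideanSpace ℝ (Fin d) → EuclideanSpace ℝ (Fin p))
    (θ : EuclideanSpace ℝ (Fin p)) : Measure (EuclideanSpace ℝ (Fin d)) :=
  μ.withDensity fun x => ENNReal.ofReal (Real.exp (-(inner ℝ θ (F x)) - logPartition μ F θ))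

/-- The Gibbs measure off a set `N`: its density with respect to `μ` is
`exp (-⟨θ, F x⟩) / ∫_{Nᶜ} exp (-⟨θ, F⟩) dμ` for `x ∉ N`, and `0` for `x ∈ N`. -/
def gibbsOff (μ : Measure (EuclideanSpace ℝ (Fin d)))
    (F : EuclideanSpace ℝ (Fin d) → EuclideanSpace ℝ (Fin p))
    (θ : EuclideanSpace ℝ (Fin p)) (N : Set (EuclideanSpace ℝ (Fin d))) :
    Measure (EuclideanSpace ℝ (Fin d)) :=
  μ.withDensity (Nᶜ.indicator fun x =>
    ENNReal.ofReal (Real.exp (-(inner ℝ θ (F x))) /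
      ∫ y in Nᶜ, Real.exp (-(inner ℝ θ (F y))) ∂μ))

/-- The solution of (P) is the Gibbs measure with parameter `θ` off the Borel set `N`, where `N` is
null for every admissible measure with finite relative entropy and the normalizing integral is
finite. The last clause says that this Gibbs measure is a solution of (P), and the only one. -/
def SolutionIsGibbs (μ : Measure (EuclideanSpace ℝ (Fin d)))
    (F : EuclideanSpace ℝ (Fin d) → EuclideanSpace ℝ (Fin p)) (α : ℝ)
    (θ : EuclideanSpace ℝ (Fin p)) (N : Set (EuclideanSpace ℝ (Fin d))) : Prop :=
  MeasurableSet N ∧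
  (∀ π ∈ admissible F α, klDiv π μ < ∞ → π N = 0) ∧
  IntegrableOn (fun x => Real.exp (-(inner ℝ θ (F x)))) Nᶜ μ ∧
  ∀ π, IsPrimalSolution μ F α π ↔ π = gibbsOff μ F θ N

end MaxEnt

end

/-! Measures of finite relative entropy are replaced by densities `f`, with entropy `∫ klFun f`, and
a minimal `f` is tested against two kinds of perturbation. The densities `f * (1 + t * h)`, with `h`
simple and orthogonal to `f` and to every `f * F i`, stay admissible for small `t` of either sign,
so `∫ h * (f * log f) = 0`. Finite-dimensional linear algebra
(`exists_ae_eq_sum_of_forall_simpleFunc`) then makes `f * log f` a combination of `f` and the `f * F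
i`, which is the Gibbs form wherever `f ≠ 0`. Moving towards another admissible `g` exploits the
infinite slope of `klFun` at `0`: unless `g` vanishes where `f` does, a small step would lower the
entropy (`IsMinimalDensity.ae_eq_zero`). Hence `N` is the zero set of `f`.

If an admissible measure of finite entropy dominates `μ`, then `N` is `μ`-null. The tangent
inequality for `klFun` at the Gibbs density shows that it minimizes the Lagrangian, which closes the
duality gap.

Existence in (b) needs no weak compactness. Quantitative midpoint convexity makes a minimizing
sequence Cauchy in `L¹`, and Fatou's lemma gives lower semicontinuity. Young's inequality and the
exponential moment bound the moments of order `α'` uniformly, so the constraints, which grow only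
like `‖x‖ ^ α`, pass to the limit. -/

open Filter Topology

/-! ### Pointwise inequalities for `klFun`. -/

section KLFun

/-- Multiplying `log (√m / √a) ≤ √m / √a - 1` by `2 * a` bounds the Bregman divergence of `klFun`
below by the squared Hellinger term. -/
theorem klFun_add_log_mul_add_sq_le {a m : ℝ} (ha : 0 ≤ a) (hm : 0 < m) :
    klFun m + Real.log m * (a - m) + (√a - √m) ^ 2 ≤ klFun a := by
  have hr : 0 < √m := Real.sqrt_pos.2 hm
  have hrm : √m ^ 2 = m := Real.sq_sqrt hm.le
  have hsa : √a ^ 2 = a := Real.sq_sqrt ha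
  rcases ha.eq_or_lt with rfl | ha
  · simp only [klFun_apply, Real.sqrt_zero]
    nlinarith
  have hs : 0 < √a := Real.sqrt_pos.2 ha
  have h := Real.log_le_sub_one_of_pos (div_pos hr hs)
  rw [Real.log_div hr.ne' hs.ne', Real.log_sqrt hm.le, Real.log_sqrt ha.le] at h
  have h2 : 2 * a * (Real.log m / 2 - Real.log a / 2) ≤ 2 * a * (√m / √a - 1) :=
    mul_le_mul_of_nonneg_left h (by linarith)
  have h3 : a * (√m / √a) = √a * √m := by
    nth_rw 1 [← hsa]
    field_simp
  simp only [klFun_apply]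
  nlinarith

theorem klFun_add_log_mul_le {a m : ℝ} (ha : 0 ≤ a) (hm : 0 < m) :
    klFun m + Real.log m * (a - m) ≤ klFun a := by
  nlinarith [klFun_add_log_mul_add_sq_le ha hm, sq_nonneg (√a - √m)]

/-- Young's inequality for the conjugate pair `a * log a - a`, `exp`. -/
theorem mul_le_klFun_sub_one_add_exp {a : ℝ} (ha : 0 ≤ a) (y : ℝ) :
    a * y ≤ klFun a - 1 + Real.exp y := by
  have h := klFun_add_log_mul_le ha (Real.exp_pos y)
  rw [klFun_apply (Real.exp y), Real.log_exp] at h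
  linarith

/-- Quantitative strict convexity of `klFun` at midpoints. -/
theorem klFun_midpoint_add_abs_sub_le {a b δ : ℝ} (ha : 0 ≤ a) (hb : 0 ≤ b) :
    klFun ((1 - 1 / 2) * a + 1 / 2 * b) + δ / 2 * |a - b| ≤
      (klFun a + klFun b) / 2 + δ ^ 2 / 2 * (a + b) := by
  rcases (add_nonneg ha hb).eq_or_lt with h0 | h0
  · obtain rfl : a = 0 := by linarith
    obtain rfl : b = 0 := by linarith
    simp
  have hsa : √a ^ 2 = a := Real.sq_sqrt ha
  have hsb : √b ^ 2 = b := Real.sq_sqrt hb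
  have hm : 0 < (1 - 1 / 2) * a + 1 / 2 * b := by linarith
  have h1 := klFun_add_log_mul_add_sq_le ha hm
  have h2 := klFun_add_log_mul_add_sq_le hb hm
  set m := (1 - 1 / 2) * a + 1 / 2 * b with hmd
  have h12 : 2 * klFun m + ((√a - √m) ^ 2 + (√b - √m) ^ 2) ≤ klFun a + klFun b := by
    have : Real.log m * (a - m) + Real.log m * (b - m) = 0 := by rw [hmd]; ring
    linarith
  have h3 : |a - b| = |√a - √b| * (√a + √b) := by
    rw [← abs_of_nonneg (add_nonneg (Real.sqrt_nonneg a) (Real.sqrt_nonneg b)), ← abs_mul]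
    congr 1
    nlinarith
  have h4 : |√a - √b| ^ 2 = (√a - √b) ^ 2 := sq_abs _
  rw [h3]
  -- The two Hellinger terms sum to at least `(√a - √b) ^ 2 / 2`. Weighted AM-GM with the free
  -- parameter `δ` trades this for `|a - b|`.
  nlinarith [sq_nonneg (|√a - √b| - δ * (√a + √b)), sq_nonneg ((√a - √m) + (√b - √m)),
    mul_nonneg (sq_nonneg δ) (sq_nonneg (√a - √b))]

/-- From `log (1 + u) ≤ u`. An explicit second-order remainder lets the first variation be computed
without differentiating under the integral. -/
theorem klFun_mul_one_add_le {a u : ℝ} (ha : 0 ≤ a) (hu : 0 ≤ 1 + u) :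
    klFun (a * (1 + u)) ≤ klFun a + u * (a * Real.log a) + u ^ 2 * a := by
  rcases ha.eq_or_lt with rfl | ha
  · simp
  rcases hu.eq_or_lt with hu | hu
  · obtain rfl : u = -1 := by linarith
    simp only [add_neg_cancel, mul_zero, klFun_apply]
    linarith
  have h := Real.log_le_sub_one_of_pos hu
  have h2 : a * (1 + u) * Real.log (1 + u) ≤ a * (1 + u) * (1 + u - 1) :=
    mul_le_mul_of_nonneg_left h (by positivity)
  rw [klFun_apply, klFun_apply, Real.log_mul ha.ne' hu.ne']
  nlinarith

theorem klFun_convexCombo_le {a b t : ℝ} (ha : 0 ≤ a) (hb : 0 ≤ b) (ht : 0 < t) (ht1 : t < 1) :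
    klFun ((1 - t) * a + t * b) ≤ (1 - t) * klFun a + t * klFun b := by
  have := convexOn_klFun.2 ha hb (sub_nonneg.2 ht1.le) ht.le (by ring)
  simpa using this

/-- Leaving `0` along a segment gains `t * log t * b` over the chord; this is the infinite slope of
`klFun` at `0`. -/
theorem klFun_mul_eq {b t : ℝ} (ht : 0 < t) :
    klFun (t * b) = (1 - t) * klFun 0 + t * klFun b + t * Real.log t * b := by
  rcases eq_or_ne b 0 with rfl | hb
  · simp only [mul_zero, add_zero]
    ring
  rw [klFun_apply, klFun_apply, klFun_apply, Real.log_mul ht.ne' hb]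
  ring

end KLFun

/-! ### Duality with finitely many linear constraints. -/

section Span

variable {X : Type*} [MeasurableSpace X] {μ : Measure X}

theorem MeasureTheory.SimpleFunc.integrable_mul (h : SimpleFunc X ℝ) {g : X → ℝ}
    (hg : Integrable g μ) : Integrable (fun x => h x * g x) μ := by
  obtain ⟨C, hC⟩ := h.exists_forall_norm_le
  exact hg.bdd_mul h.measurable.aestronglyMeasurable (ae_of_all _ hC)

/-- Integration of simple functions against an integrable function. -/
noncomputable def simpleFuncPairing (g : X → ℝ) (hg : Integrable g μ) :
    SimpleFunc X ℝ →ₗ[ℝ] ℝ where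
  toFun h := ∫ x, h x * g x ∂μ
  map_add' h k := by
    simp only [SimpleFunc.coe_add, Pi.add_apply, add_mul]
    exact integral_add (h.integrable_mul hg) (k.integrable_mul hg)
  map_smul' c h := by
    simp only [SimpleFunc.coe_smul, Pi.smul_apply, smul_eq_mul, mul_assoc, RingHom.id_apply]
    exact integral_const_mul _ _

/-- If every simple function orthogonal to finitely many integrable functions `G i` is orthogonal to
`g`, then `g` is a linear combination of the `G i`. -/
theorem exists_ae_eq_sum_of_forall_simpleFunc {ι : Type*} [Fintype ι] {g : X → ℝ} {G : ι → X → ℝ}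
    (hg : Integrable g μ) (hG : ∀ i, Integrable (G i) μ)
    (H : ∀ h : SimpleFunc X ℝ, (∀ i, ∫ x, h x * G i x ∂μ = 0) → ∫ x, h x * g x ∂μ = 0) :
    ∃ c : ι → ℝ, g =ᵐ[μ] fun x => ∑ i, c i * G i x := by
  have hker : ⨅ i, LinearMap.ker (simpleFuncPairing (G i) (hG i)) ≤
      LinearMap.ker (simpleFuncPairing g hg) := by
    intro h hh
    rw [Submodule.mem_iInf] at hh
    exact H h fun i => hh i
  obtain ⟨c, hc⟩ := (Submodule.mem_span_range_iff_exists_fun ℝ).1 (mem_span_of_iInf_ker_le_ker hker)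
  have hS : Integrable (fun x => ∑ i, c i * G i x) μ :=
    integrable_finsetSum _ fun i _ => (hG i).const_mul (c i)
  refine ⟨c, Integrable.ae_eq_of_forall_setIntegral_eq _ _ hg hS fun s hs _ => ?_⟩
  -- Evaluating the identity of functionals at the indicator of `s` gives equality of the integrals
  -- over `s`.
  have h1 := LinearMap.congr_fun hc (SimpleFunc.piecewise s hs (SimpleFunc.const X 1) 0)
  have h2 : ∀ (k : X → ℝ), ∫ x, (SimpleFunc.piecewise s hs (SimpleFunc.const X (1 : ℝ)) 0) x * k x ∂μ
      = ∫ x in s, k x ∂μ := by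
    intro k
    rw [← integral_indicator hs]
    congr 1
    ext x
    by_cases hx : x ∈ s <;> simp [hx]
  simp only [LinearMap.coe_sum, Finset.sum_apply, LinearMap.smul_apply, smul_eq_mul,
    simpleFuncPairing, LinearMap.coe_mk, AddHom.coe_mk, h2] at h1
  rw [← h1, integral_finsetSum _ fun i _ => ((hG i).const_mul (c i)).integrableOn]
  simp [integral_const_mul]

end Span

/-! ### From measures to densities. -/

namespace MaxEnt

section Densities

variable {d p : ℕ} {μ : Measure (EuclideanSpace ℝ (Fin d))}
  {F : EuclideanSpace ℝ (Fin d) → EuclideanSpace ℝ (Fin p)} {α : ℝ}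

/-- `f` is a probability density with respect to `μ` with finite relative entropy, a finite moment
of order `α` and integrable features. -/
structure IsEntropyDensity (μ : Measure (EuclideanSpace ℝ (Fin d)))
    (F : EuclideanSpace ℝ (Fin d) → EuclideanSpace ℝ (Fin p)) (α : ℝ)
    (f : EuclideanSpace ℝ (Fin d) → ℝ) : Prop where
  measurable : Measurable f
  nonneg : ∀ x, 0 ≤ f x
  integrable : Integrable f μ
  integral_eq_one : ∫ x, f x ∂μ = 1
  integrable_moment : Integrable (fun x => f x * ‖x‖ ^ α) μ
  integrable_features : Integrable (fun x => f x • F x) μ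
  integrable_klFun : Integrable (fun x => klFun (f x)) μ

/-- `f` is the density of an admissible measure with finite relative entropy. -/
def IsAdmissibleDensity (μ : Measure (EuclideanSpace ℝ (Fin d)))
    (F : EuclideanSpace ℝ (Fin d) → EuclideanSpace ℝ (Fin p)) (α : ℝ)
    (f : EuclideanSpace ℝ (Fin d) → ℝ) : Prop :=
  IsEntropyDensity μ F α f ∧ ∫ x, f x • F x ∂μ = 0

/-- The measure with density `f` with respect to `μ`. -/
noncomputable def ofDensity (μ : Measure (EuclideanSpace ℝ (Fin d)))
    (f : EuclideanSpace ℝ (Fin d) → ℝ) : Measure (EuclideanSpace ℝ (Fin d)) :=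
  μ.withDensity fun x => ENNReal.ofReal (f x)

/-- The relative entropy of the measure with density `f` with respect to `μ`. -/
noncomputable def entropy (μ : Measure (EuclideanSpace ℝ (Fin d)))
    (f : EuclideanSpace ℝ (Fin d) → ℝ) : ℝ :=
  ∫ x, klFun (f x) ∂μ

theorem integral_ofDensity {E : Type*} [NormedAddCommGroup E] [NormedSpace ℝ E]
    {f : EuclideanSpace ℝ (Fin d) → ℝ} (hf : Measurable f) (h0 : ∀ x, 0 ≤ f x)
    (g : EuclideanSpace ℝ (Fin d) → E) :
    ∫ x, g x ∂(ofDensity μ f) = ∫ x, f x • g x ∂μ := by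
  rw [ofDensity, integral_withDensity_eq_integral_toReal_smul hf.ennreal_ofReal
    (ae_of_all _ fun x => ENNReal.ofReal_lt_top)]
  simp only [ENNReal.toReal_ofReal (h0 _)]

theorem integrable_ofDensity_iff {E : Type*} [NormedAddCommGroup E] [NormedSpace ℝ E]
    {f : EuclideanSpace ℝ (Fin d) → ℝ} (hf : Measurable f) (h0 : ∀ x, 0 ≤ f x)
    {g : EuclideanSpace ℝ (Fin d) → E} :
    Integrable g (ofDensity μ f) ↔ Integrable (fun x => f x • g x) μ := by
  rw [ofDensity, integrable_withDensity_iff_integrable_smul' hf.ennreal_ofReal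
    (ae_of_all _ fun x => ENNReal.ofReal_lt_top)]
  simp only [ENNReal.toReal_ofReal (h0 _)]

theorem IsEntropyDensity.entropy_nonneg {f : EuclideanSpace ℝ (Fin d) → ℝ}
    (hf : IsEntropyDensity μ F α f) : 0 ≤ entropy μ f :=
  integral_nonneg fun x => klFun_nonneg (hf.nonneg x)

theorem IsEntropyDensity.isProbabilityMeasure {f : EuclideanSpace ℝ (Fin d) → ℝ}
    (hf : IsEntropyDensity μ F α f) : IsProbabilityMeasure (ofDensity μ f) := by
  constructor
  rw [ofDensity, withDensity_apply _ .univ, Measure.restrict_univ,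
    ← ofReal_integral_eq_lintegral_ofReal hf.integrable (ae_of_all _ hf.nonneg),
    hf.integral_eq_one, ENNReal.ofReal_one]

theorem IsEntropyDensity.klDiv_eq [IsProbabilityMeasure μ] {f : EuclideanSpace ℝ (Fin d) → ℝ}
    (hf : IsEntropyDensity μ F α f) : klDiv (ofDensity μ f) μ = ENNReal.ofReal (entropy μ f) := by
  have := hf.isProbabilityMeasure
  have hac : ofDensity μ f ≪ μ := withDensity_absolutelyContinuous _ _
  rw [klDiv_eq_lintegral_klFun_of_ac hac, entropy,
    ofReal_integral_eq_lintegral_ofReal hf.integrable_klFun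
      (ae_of_all _ fun x => klFun_nonneg (hf.nonneg x))]
  refine lintegral_congr_ae ?_
  filter_upwards [Measure.rnDeriv_withDensity μ hf.measurable.ennreal_ofReal] with x hx
  rw [ofDensity, hx, ENNReal.toReal_ofReal (hf.nonneg x)]

theorem IsEntropyDensity.mem_probMoment {f : EuclideanSpace ℝ (Fin d) → ℝ}
    (hf : IsEntropyDensity μ F α f) : ofDensity μ f ∈ probMoment d α :=
  ⟨hf.isProbabilityMeasure,
    (integrable_ofDensity_iff hf.measurable hf.nonneg).2 hf.integrable_moment⟩

theorem IsAdmissibleDensity.mem_admissible {f : EuclideanSpace ℝ (Fin d) → ℝ}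
    (hf : IsAdmissibleDensity μ F α f) : ofDensity μ f ∈ admissible F α :=
  ⟨hf.1.mem_probMoment, (integrable_ofDensity_iff hf.1.measurable hf.1.nonneg).2
    hf.1.integrable_features, by rw [integral_ofDensity hf.1.measurable hf.1.nonneg, hf.2]⟩

theorem A1.norm_le (hA1 : A1 F α) : ∃ C : ℝ, 0 ≤ C ∧ ∀ x, ‖F x‖ ≤ C * (1 + ‖x‖ ^ α) := by
  obtain ⟨-, C, hC, h⟩ := hA1
  refine ⟨C, hC, fun x => ?_⟩
  have h1 : 0 < 1 + ‖x‖ ^ α := by positivity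
  have := h x
  rwa [← div_eq_mul_inv, div_le_iff₀ h1] at this

theorem A1.integrable (hA1 : A1 F α) {π : Measure (EuclideanSpace ℝ (Fin d))}
    (hπ : π ∈ probMoment d α) : Integrable F π := by
  obtain ⟨C, -, hC⟩ := hA1.norm_le
  have : IsProbabilityMeasure π := hπ.1
  exact (((integrable_const 1).add hπ.2).const_mul C).mono' hA1.1.aestronglyMeasurable
    (ae_of_all _ hC)

/-- Finite relative entropy forces `π ≪ μ`, so the real-valued Radon–Nikodym derivative serves. -/
theorem exists_isEntropyDensity [IsProbabilityMeasure μ] {π : Measure (EuclideanSpace ℝ (Fin d))}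
    (hπ : π ∈ probMoment d α) (hF : Integrable F π) (hkl : klDiv π μ < ∞) :
    ∃ f, IsEntropyDensity μ F α f ∧ π = ofDensity μ f := by
  have : IsProbabilityMeasure π := hπ.1
  have := Measure.haveLebesgueDecomposition_of_sigmaFinite π μ
  obtain ⟨hac, hllr⟩ := klDiv_ne_top_iff.1 hkl.ne
  set f := fun x => (π.rnDeriv μ x).toReal with hf
  have hm : Measurable f := (Measure.measurable_rnDeriv π μ).ennreal_toReal
  have h0 : ∀ x, 0 ≤ f x := fun x => ENNReal.toReal_nonneg
  have hπf : π = ofDensity μ f := by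
    refine (Measure.withDensity_rnDeriv_eq π μ hac).symm.trans (withDensity_congr_ae ?_)
    filter_upwards [Measure.rnDeriv_lt_top π μ] with x hx
    rw [hf, ENNReal.ofReal_toReal hx.ne]
  refine ⟨f, ⟨hm, h0, Measure.integrable_toReal_rnDeriv, ?_, ?_, ?_, ?_⟩, hπf⟩
  · rw [Measure.integral_toReal_rnDeriv hac, probReal_univ]
  · have := hπ.2
    rw [hπf, integrable_ofDensity_iff hm h0] at this
    exact this
  · rw [hπf, integrable_ofDensity_iff hm h0] at hF
    exact hF
  · exact (integrable_klFun_rnDeriv_iff hac).2 hllr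

theorem exists_isAdmissibleDensity [IsProbabilityMeasure μ]
    {π : Measure (EuclideanSpace ℝ (Fin d))} (hπ : π ∈ admissible F α) (hkl : klDiv π μ < ∞) :
    ∃ f, IsAdmissibleDensity μ F α f ∧ π = ofDensity μ f := by
  obtain ⟨f, hf, rfl⟩ := exists_isEntropyDensity hπ.1 hπ.2.1 hkl
  exact ⟨f, ⟨hf, by rw [← integral_ofDensity hf.measurable hf.nonneg, hπ.2.2]⟩, rfl⟩

theorem IsEntropyDensity.integrable_mul_feature {f : EuclideanSpace ℝ (Fin d) → ℝ}
    (hf : IsEntropyDensity μ F α f) (i : Fin p) : Integrable (fun x => f x * F x i) μ :=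
  (EuclideanSpace.proj (𝕜 := ℝ) i).integrable_comp hf.integrable_features

theorem IsEntropyDensity.integrable_mul_log {f : EuclideanSpace ℝ (Fin d) → ℝ}
    [IsProbabilityMeasure μ] (hf : IsEntropyDensity μ F α f) :
    Integrable (fun x => f x * Real.log (f x)) μ := by
  have := (hf.integrable_klFun.sub (integrable_const 1)).add hf.integrable
  refine this.congr (ae_of_all _ fun x => ?_)
  simp only [Pi.add_apply, Pi.sub_apply, klFun_apply]
  ring

theorem IsAdmissibleDensity.convexCombo [IsProbabilityMeasure μ]
    {f g : EuclideanSpace ℝ (Fin d) → ℝ}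
    (hf : IsAdmissibleDensity μ F α f) (hg : IsAdmissibleDensity μ F α g) {t : ℝ} (ht : 0 < t)
    (ht1 : t < 1) : IsAdmissibleDensity μ F α fun x => (1 - t) * f x + t * g x := by
  have hm : Measurable fun x => (1 - t) * f x + t * g x :=
    (hf.1.measurable.const_mul _).add (hg.1.measurable.const_mul _)
  have h0 : ∀ x, 0 ≤ (1 - t) * f x + t * g x := fun x =>
    add_nonneg (mul_nonneg (by linarith) (hf.1.nonneg x)) (mul_nonneg ht.le (hg.1.nonneg x))
  have hI := (hf.1.integrable_features.smul (1 - t)).add (hg.1.integrable_features.smul t)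
  have hE : (fun x => ((1 - t) * f x + t * g x) • F x) =
      (1 - t) • (fun x => f x • F x) + t • (fun x => g x • F x) := by
    ext1 x
    simp [add_smul, mul_smul]
  refine ⟨⟨hm, h0, (hf.1.integrable.const_mul _).add (hg.1.integrable.const_mul _), ?_, ?_, ?_, ?_⟩,
    ?_⟩
  · rw [integral_add (hf.1.integrable.const_mul _) (hg.1.integrable.const_mul _),
      integral_const_mul, integral_const_mul, hf.1.integral_eq_one, hg.1.integral_eq_one]
    ring
  · refine ((hf.1.integrable_moment.const_mul (1 - t)).add
      (hg.1.integrable_moment.const_mul t)).congr (ae_of_all _ fun x => ?_)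
    simp only [Pi.add_apply]
    ring
  · rw [hE]
    exact hI
  · refine ((hf.1.integrable_klFun.const_mul (1 - t)).add
      (hg.1.integrable_klFun.const_mul t)).mono' (measurable_klFun.comp hm).aestronglyMeasurable
      (ae_of_all _ fun x => ?_)
    rw [Real.norm_of_nonneg (klFun_nonneg (h0 x))]
    exact klFun_convexCombo_le (hf.1.nonneg x) (hg.1.nonneg x) ht ht1
  · rw [hE]
    rw [integral_add' (hf.1.integrable_features.smul (1 - t)) (hg.1.integrable_features.smul t)]
    simp only [Pi.smul_apply]
    rw [integral_smul, integral_smul, hf.2, hg.2]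
    simp

/-- `f` minimizes the relative entropy among densities of admissible measures. -/
def IsMinimalDensity (μ : Measure (EuclideanSpace ℝ (Fin d)))
    (F : EuclideanSpace ℝ (Fin d) → EuclideanSpace ℝ (Fin p)) (α : ℝ)
    (f : EuclideanSpace ℝ (Fin d) → ℝ) : Prop :=
  IsAdmissibleDensity μ F α f ∧ ∀ g, IsAdmissibleDensity μ F α g → entropy μ f ≤ entropy μ g

theorem IsMinimalDensity.isPrimalSolution [IsProbabilityMeasure μ]
    {f : EuclideanSpace ℝ (Fin d) → ℝ} (hf : IsMinimalDensity μ F α f) :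
    IsPrimalSolution μ F α (ofDensity μ f) := by
  refine ⟨hf.1.mem_admissible, fun π hπ => ?_⟩
  rcases eq_top_or_lt_top (klDiv π μ) with h | h
  · exact h ▸ le_top
  obtain ⟨g, hg, rfl⟩ := exists_isAdmissibleDensity hπ h
  rw [hf.1.1.klDiv_eq, hg.1.klDiv_eq]
  exact ENNReal.ofReal_le_ofReal (hf.2 g hg)

theorem IsPrimalSolution.exists_isMinimalDensity [IsProbabilityMeasure μ]
    {π : Measure (EuclideanSpace ℝ (Fin d))} (hπ : IsPrimalSolution μ F α π)
    (hkl : klDiv π μ < ∞) : ∃ f, IsMinimalDensity μ F α f ∧ π = ofDensity μ f := by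
  obtain ⟨f, hf, rfl⟩ := exists_isAdmissibleDensity hπ.1 hkl
  refine ⟨f, ⟨hf, fun g hg => ?_⟩, rfl⟩
  have := hπ.2 _ hg.mem_admissible
  rwa [hf.1.klDiv_eq, hg.1.klDiv_eq, ENNReal.ofReal_le_ofReal_iff hg.1.entropy_nonneg] at this

theorem IsPrimalSolution.klDiv_eq_primalValue {π : Measure (EuclideanSpace ℝ (Fin d))}
    (hπ : IsPrimalSolution μ F α π) : klDiv π μ = primalValue μ F α :=
  le_antisymm (le_iInf₂ hπ.2) (iInf₂_le π hπ.1)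

end Densities

end MaxEnt

/-! ### Uniqueness and shape of minimal densities. -/

namespace MaxEnt

section Minimal

variable {d p : ℕ} {μ : Measure (EuclideanSpace ℝ (Fin d))} [IsProbabilityMeasure μ]
  {F : EuclideanSpace ℝ (Fin d) → EuclideanSpace ℝ (Fin p)} {α : ℝ}

/-- Admissible densities that almost minimize the relative entropy are close in `L¹`. -/
theorem integral_abs_sub_le_of_entropy_le {f g : EuclideanSpace ℝ (Fin d) → ℝ}
    (hf : IsAdmissibleDensity μ F α f) (hg : IsAdmissibleDensity μ F α g) {V δ : ℝ} (hδ : 0 < δ)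
    (hV : ∀ h, IsAdmissibleDensity μ F α h → V ≤ entropy μ h) (hfV : entropy μ f ≤ V + δ ^ 2)
    (hgV : entropy μ g ≤ V + δ ^ 2) : ∫ x, |f x - g x| ∂μ ≤ 4 * δ := by
  have hm := hf.convexCombo hg (t := 1 / 2) (by norm_num) (by norm_num)
  have hI := (hf.1.integrable.sub hg.1.integrable).abs
  have h1 : ∫ x, (klFun ((1 - 1 / 2) * f x + 1 / 2 * g x) + δ / 2 * |f x - g x|) ∂μ ≤
      ∫ x, ((klFun (f x) + klFun (g x)) / 2 + δ ^ 2 / 2 * (f x + g x)) ∂μ := by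
    refine integral_mono (hm.1.integrable_klFun.add (hI.const_mul _)) ?_ fun x =>
      klFun_midpoint_add_abs_sub_le (hf.1.nonneg x) (hg.1.nonneg x)
    exact ((hf.1.integrable_klFun.add hg.1.integrable_klFun).div_const 2).add
      ((hf.1.integrable.add hg.1.integrable).const_mul _)
  have h2 : ∫ x, (klFun ((1 - 1 / 2) * f x + 1 / 2 * g x) + δ / 2 * |f x - g x|) ∂μ =
      entropy μ (fun x => (1 - 1 / 2) * f x + 1 / 2 * g x) + δ / 2 * ∫ x, |f x - g x| ∂μ := by
    rw [← integral_const_mul]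
    exact integral_add hm.1.integrable_klFun (hI.const_mul _)
  have h3 : ∫ x, ((klFun (f x) + klFun (g x)) / 2 + δ ^ 2 / 2 * (f x + g x)) ∂μ =
      (entropy μ f + entropy μ g) / 2 + δ ^ 2 / 2 * (1 + 1) := by
    refine (integral_add ((hf.1.integrable_klFun.add hg.1.integrable_klFun).div_const 2)
      ((hf.1.integrable.add hg.1.integrable).const_mul (δ ^ 2 / 2))).trans ?_
    rw [integral_div, integral_const_mul,
      integral_add' hf.1.integrable_klFun hg.1.integrable_klFun,
      integral_add' hf.1.integrable hg.1.integrable, hf.1.integral_eq_one, hg.1.integral_eq_one]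
    rfl
  rw [h2, h3] at h1
  have h4 := hV _ hm
  -- The two entropies average to at most `V + δ ^ 2`, the mass term adds `δ ^ 2`, and the midpoint
  -- has entropy at least `V`; this leaves `2 * δ ^ 2`.
  have h5 : δ / 2 * ∫ x, |f x - g x| ∂μ ≤ δ / 2 * (4 * δ) := by nlinarith
  exact le_of_mul_le_mul_left h5 (by positivity)

theorem IsMinimalDensity.ae_eq {f g : EuclideanSpace ℝ (Fin d) → ℝ}
    (hf : IsMinimalDensity μ F α f) (hg : IsMinimalDensity μ F α g) : f =ᵐ[μ] g := by
  have h0 : ∫ x, |f x - g x| ∂μ = 0 := by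
    refine le_antisymm (le_of_forall_pos_le_add fun ε hε => ?_)
      (integral_nonneg fun x => abs_nonneg _)
    have := integral_abs_sub_le_of_entropy_le hf.1 hg.1 (V := entropy μ f) (δ := ε / 4)
      (by positivity) hf.2 (by nlinarith) (by nlinarith [hg.2 f hf.1])
    linarith
  have h1 := (integral_eq_zero_iff_of_nonneg (fun x => abs_nonneg _)
    (hf.1.1.integrable.sub hg.1.1.integrable).abs).1 h0
  filter_upwards [h1] with x hx
  exact sub_eq_zero.1 (abs_eq_zero.1 hx)

theorem IsAdmissibleDensity.mul_one_add {f : EuclideanSpace ℝ (Fin d) → ℝ}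
    (hf : IsAdmissibleDensity μ F α f) {h : SimpleFunc (EuclideanSpace ℝ (Fin d)) ℝ}
    (hh : ∀ x, 0 ≤ 1 + h x) (h1 : ∫ x, h x * f x ∂μ = 0)
    (hF : ∀ i, ∫ x, h x * (f x * F x i) ∂μ = 0) :
    IsAdmissibleDensity μ F α fun x => f x * (1 + h x) := by
  have hm : Measurable fun x => f x * (1 + h x) :=
    hf.1.measurable.mul (measurable_const.add h.measurable)
  have h0 : ∀ x, 0 ≤ f x * (1 + h x) := fun x => mul_nonneg (hf.1.nonneg x) (hh x)
  obtain ⟨C, hC⟩ := h.exists_forall_norm_le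
  have hFi : Integrable (fun x => h x • (f x • F x)) μ :=
    hf.1.integrable_features.bdd_smul C h.measurable.aestronglyMeasurable (ae_of_all _ hC)
  have hE : (fun x => (f x * (1 + h x)) • F x) = (fun x => f x • F x) + fun x => h x • f x • F x := by
    ext1 x
    simp only [Pi.add_apply, smul_smul, ← add_smul]
    congr 1
    ring
  refine ⟨⟨hm, h0, ?_, ?_, ?_, ?_, ?_⟩, ?_⟩
  · refine (hf.1.integrable.add (h.integrable_mul hf.1.integrable)).congr (ae_of_all _ fun x => ?_)
    simp only [Pi.add_apply]
    ring
  · have h2 := integral_add hf.1.integrable (h.integrable_mul hf.1.integrable)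
    rw [h1, hf.1.integral_eq_one, add_zero] at h2
    refine (integral_congr_ae (ae_of_all _ fun x => ?_)).trans h2
    ring
  · refine (hf.1.integrable_moment.add (h.integrable_mul hf.1.integrable_moment)).congr
      (ae_of_all _ fun x => ?_)
    simp only [Pi.add_apply]
    ring
  · rw [hE]
    exact hf.1.integrable_features.add hFi
  · have hI := (hf.1.integrable_klFun.add (h.integrable_mul hf.1.integrable_mul_log)).add
      ((h * h).integrable_mul hf.1.integrable)
    refine hI.mono' (measurable_klFun.comp hm).aestronglyMeasurable (ae_of_all _ fun x => ?_)
    rw [Real.norm_of_nonneg (klFun_nonneg (h0 x))]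
    have := klFun_mul_one_add_le (hf.1.nonneg x) (hh x)
    simp only [Pi.add_apply, SimpleFunc.coe_mul, Pi.mul_apply]
    linarith
  · rw [hE, integral_add' hf.1.integrable_features hFi, hf.2, zero_add]
    ext i
    have := (EuclideanSpace.proj (𝕜 := ℝ) i).integral_comp_comm hFi
    simp only [PiLp.proj_apply, PiLp.smul_apply, smul_eq_mul, hF] at this
    simpa using this.symm

theorem IsAdmissibleDensity.entropy_mul_one_add_le {f : EuclideanSpace ℝ (Fin d) → ℝ}
    (hf : IsAdmissibleDensity μ F α f) {h : SimpleFunc (EuclideanSpace ℝ (Fin d)) ℝ}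
    (hh : ∀ x, 0 ≤ 1 + h x) (h1 : ∫ x, h x * f x ∂μ = 0)
    (hF : ∀ i, ∫ x, h x * (f x * F x i) ∂μ = 0) :
    entropy μ (fun x => f x * (1 + h x)) ≤ entropy μ f + ∫ x, h x * (f x * Real.log (f x)) ∂μ +
      ∫ x, h x ^ 2 * f x ∂μ := by
  have hI2 : Integrable (fun x => h x ^ 2 * f x) μ := by
    refine ((h * h).integrable_mul hf.1.integrable).congr (ae_of_all _ fun x => ?_)
    simp only [SimpleFunc.coe_mul, Pi.mul_apply]
    ring
  have hI1 := h.integrable_mul hf.1.integrable_mul_log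
  have hI0 := hf.1.integrable_klFun
  have := integral_mono (hf.mul_one_add hh h1 hF).1.integrable_klFun ((hI0.add hI1).add hI2)
    fun x => klFun_mul_one_add_le (hf.1.nonneg x) (hh x)
  rw [integral_add' (hI0.add hI1) hI2, integral_add' hI0 hI1] at this
  exact this

/-- The choice `t = -A / (1 + |B| + |A| * C)` is small enough to be allowed and makes the linear
term beat the quadratic one. -/
theorem eq_zero_of_forall_small {A B C : ℝ} (hC : 0 < C)
    (h : ∀ t : ℝ, |t| * C ≤ 1 → 0 ≤ t * A + t ^ 2 * B) : A = 0 := by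
  by_contra hA
  have hA2 : 0 < A ^ 2 := by positivity
  have hD : 0 < 1 + |B| + |A| * C := by positivity
  have h1 := h (-A * (1 / (1 + |B| + |A| * C))) (by
    rw [abs_mul, abs_neg, abs_of_pos (one_div_pos.2 hD), mul_one_div, div_mul_eq_mul_div,
      div_le_one hD]
    linarith [abs_nonneg B])
  have h2 : -A * (1 / (1 + |B| + |A| * C)) * A + (-A * (1 / (1 + |B| + |A| * C))) ^ 2 * B =
      A ^ 2 / (1 + |B| + |A| * C) ^ 2 * (B - (1 + |B| + |A| * C)) := by
    field_simp
    ring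
  rw [h2] at h1
  have h3 : 0 < A ^ 2 / (1 + |B| + |A| * C) ^ 2 := by positivity
  have h4 : B - (1 + |B| + |A| * C) < 0 := by
    have := le_abs_self B
    have := mul_nonneg (abs_nonneg A) hC.le
    linarith
  nlinarith

/-- Stationarity: `f * (1 + t * h)` is a competitor for small `t` of both signs, so the linear
coefficient of the entropy bound must vanish. -/
theorem IsMinimalDensity.integral_mul_log_eq_zero {f : EuclideanSpace ℝ (Fin d) → ℝ}
    (hf : IsMinimalDensity μ F α f) (h : SimpleFunc (EuclideanSpace ℝ (Fin d)) ℝ)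
    (h1 : ∫ x, h x * f x ∂μ = 0) (hF : ∀ i, ∫ x, h x * (f x * F x i) ∂μ = 0) :
    ∫ x, h x * (f x * Real.log (f x)) ∂μ = 0 := by
  obtain ⟨C, hC⟩ := h.exists_forall_norm_le
  refine eq_zero_of_forall_small (B := ∫ x, h x ^ 2 * f x ∂μ) (C := |C| + 1) (by positivity)
    fun t ht => ?_
  have key : ∀ k : EuclideanSpace ℝ (Fin d) → ℝ,
      ∫ x, (t • h) x * k x ∂μ = t * ∫ x, h x * k x ∂μ := by
    intro k
    rw [← integral_const_mul]
    simp [mul_assoc]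
  have hh : ∀ x, 0 ≤ 1 + (t • h) x := by
    intro x
    have h3 : |t * h x| ≤ 1 := by
      rw [abs_mul]
      refine (mul_le_mul_of_nonneg_left ?_ (abs_nonneg t)).trans ht
      exact (hC x).trans ((le_abs_self C).trans (by linarith))
    have := (abs_le.1 h3).1
    simp only [SimpleFunc.coe_smul, Pi.smul_apply, smul_eq_mul]
    linarith
  have h1' : ∫ x, (t • h) x * f x ∂μ = 0 := by rw [key, h1, mul_zero]
  have hF' : ∀ i, ∫ x, (t • h) x * (f x * F x i) ∂μ = 0 := fun i => by rw [key, hF, mul_zero]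
  have h4 := (hf.2 _ (hf.1.mul_one_add hh h1' hF')).trans
    (hf.1.entropy_mul_one_add_le hh h1' hF')
  rw [key] at h4
  have h5 : ∫ x, (t • h) x ^ 2 * f x ∂μ = t ^ 2 * ∫ x, h x ^ 2 * f x ∂μ := by
    rw [← integral_const_mul]
    simp [mul_assoc, mul_pow]
  rw [h5] at h4
  linarith

/-- On its support, a minimal density is log-affine in the features. -/
theorem IsMinimalDensity.exists_log_eq {f : EuclideanSpace ℝ (Fin d) → ℝ}
    (hf : IsMinimalDensity μ F α f) : ∃ (c : ℝ) (θ : EuclideanSpace ℝ (Fin p)),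
    ∀ᵐ x ∂μ, f x ≠ 0 → Real.log (f x) = c - inner ℝ θ (F x) := by
  -- The index `none` carries the mass constraint and `some i` the `i`-th feature.
  obtain ⟨c, hc⟩ := exists_ae_eq_sum_of_forall_simpleFunc (ι := Option (Fin p))
    (G := fun o x => o.elim (f x) fun i => f x * F x i) hf.1.1.integrable_mul_log
    (fun o => by
      cases o with
      | none => exact hf.1.1.integrable
      | some i => exact hf.1.1.integrable_mul_feature i)
    (fun h hh => hf.integral_mul_log_eq_zero h (hh none) fun i => hh (some i))
  refine ⟨c none, WithLp.toLp 2 fun i => -c (some i), ?_⟩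
  filter_upwards [hc] with x hx h0
  refine mul_left_cancel₀ h0 ?_
  rw [hx, Fintype.sum_option, PiLp.inner_apply]
  simp only [Option.elim, RCLike.inner_apply, conj_trivial, mul_sub, Finset.mul_sum]
  rw [sub_eq_add_neg, ← Finset.sum_neg_distrib, mul_comm]
  congr 1
  refine Finset.sum_congr rfl fun i _ => ?_
  ring

/-- A minimal density has the largest support among admissible densities. -/
theorem IsMinimalDensity.ae_eq_zero {f g : EuclideanSpace ℝ (Fin d) → ℝ}
    (hf : IsMinimalDensity μ F α f) (hg : IsAdmissibleDensity μ F α g) :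
    ∀ᵐ x ∂μ, f x = 0 → g x = 0 := by
  have hN : MeasurableSet {x | f x = 0} := hf.1.1.measurable (measurableSet_singleton 0)
  have hIg : Integrable ({x | f x = 0}.indicator g) μ := hg.1.integrable.indicator hN
  set I := ∫ x, {x | f x = 0}.indicator g x ∂μ with hI
  have hind : 0 ≤ {x | f x = 0}.indicator g := Set.indicator_nonneg fun x _ => hg.1.nonneg x
  -- Convexity off the zero set of `f`, the exact gain on it, and minimality of `f`, divided by `t`.
  -- As `t → 0` the right side tends to `-∞` unless `I = 0`.
  have key : ∀ t : ℝ, 0 < t → t < 1 → entropy μ f - entropy μ g ≤ Real.log t * I := by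
    intro t ht ht1
    have hfg := hf.1.convexCombo hg ht ht1
    have h1 := integral_mono hfg.1.integrable_klFun
      (((hf.1.1.integrable_klFun.const_mul (1 - t)).add (hg.1.integrable_klFun.const_mul t)).add
        (hIg.const_mul (t * Real.log t))) (fun x => by
      by_cases hx : f x = 0
      · have h2 : x ∈ {x | f x = 0} := hx
        simp only [Pi.add_apply, Set.indicator_of_mem h2, hx, mul_zero, zero_add]
        exact (klFun_mul_eq ht).le
      · have h2 : x ∉ {x | f x = 0} := hx
        simp only [Pi.add_apply, Set.indicator_of_notMem h2, mul_zero, add_zero]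
        exact klFun_convexCombo_le (hf.1.1.nonneg x) (hg.1.nonneg x) ht ht1)
    rw [integral_add' ((hf.1.1.integrable_klFun.const_mul (1 - t)).add
      (hg.1.integrable_klFun.const_mul t)) (hIg.const_mul (t * Real.log t)),
      integral_add' (hf.1.1.integrable_klFun.const_mul (1 - t))
      (hg.1.integrable_klFun.const_mul t), integral_const_mul, integral_const_mul,
      integral_const_mul] at h1
    have h3 : entropy μ f ≤ (1 - t) * entropy μ f + t * entropy μ g + t * Real.log t * I :=
      (hf.2 _ hfg).trans h1
    refine le_of_mul_le_mul_left ?_ ht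
    linarith
  have hI0 : I = 0 := by
    refine le_antisymm (not_lt.1 fun hpos => ?_) (integral_nonneg hind)
    -- For this `t`, `log t * I = -I - |entropy μ f - entropy μ g|`, which is too small.
    have h1 := key (Real.exp (-(1 + |entropy μ f - entropy μ g| / I))) (Real.exp_pos _)
      (Real.exp_lt_one_iff.2 (by rw [neg_lt_zero]; positivity))
    rw [Real.log_exp, neg_mul, add_mul, div_mul_cancel₀ _ hpos.ne'] at h1
    linarith [neg_abs_le (entropy μ f - entropy μ g)]
  rw [integral_eq_zero_iff_of_nonneg hind hIg] at hI0
  filter_upwards [hI0] with x hx h0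
  have h2 : x ∈ {x | f x = 0} := h0
  simpa [Set.indicator_of_mem h2] using hx

/-- A minimal density yields the unique solution of the primal problem, which is a Gibbs measure off
the zero set of the density. -/
theorem IsMinimalDensity.exists_solutionIsGibbs {f : EuclideanSpace ℝ (Fin d) → ℝ}
    (hf : IsMinimalDensity μ F α f) : ∃ θ N, SolutionIsGibbs μ F α θ N := by
  obtain ⟨c, θ, hc⟩ := hf.exists_log_eq
  have hN : MeasurableSet {x | f x = 0} := hf.1.1.measurable (measurableSet_singleton 0)
  have hexp : ∀ᵐ x ∂μ, f x ≠ 0 → Real.exp (-(inner ℝ θ (F x))) = Real.exp (-c) * f x := by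
    filter_upwards [hc] with x hx h0
    have hpos : 0 < f x := (hf.1.1.nonneg x).lt_of_ne' h0
    rw [show -(inner ℝ θ (F x)) = -c + Real.log (f x) by rw [hx h0]; ring, Real.exp_add,
      Real.exp_log hpos]
  have hres : ∀ᵐ x ∂μ.restrict {x | f x = 0}ᶜ,
      Real.exp (-(inner ℝ θ (F x))) = Real.exp (-c) * f x := by
    rw [ae_restrict_iff' hN.compl]
    exact hexp
  -- All the mass of `f` lies off its zero set, so the constant `c` is minus the log-normalizer.
  have hZ : ∫ x in {x | f x = 0}ᶜ, Real.exp (-(inner ℝ θ (F x))) ∂μ = Real.exp (-c) := by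
    rw [integral_congr_ae hres, integral_const_mul, setIntegral_eq_integral_of_forall_compl_eq_zero,
      hf.1.1.integral_eq_one, mul_one]
    intro x hx
    simpa using hx
  have hgibbs : gibbsOff μ F θ {x | f x = 0} = ofDensity μ f := by
    refine withDensity_congr_ae ?_
    filter_upwards [hexp] with x hx
    by_cases h0 : f x = 0
    · have h2 : x ∉ {x | f x = 0}ᶜ := fun h => h h0
      rw [Set.indicator_of_notMem h2, h0, ENNReal.ofReal_zero]
    · have h2 : x ∈ {x | f x = 0}ᶜ := h0
      rw [Set.indicator_of_mem h2, hZ, hx h0, mul_div_cancel_left₀ _ (Real.exp_pos _).ne']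
  refine ⟨θ, {x | f x = 0}, hN, fun π hπ hkl => ?_, ?_, fun π => ⟨fun hπ => ?_, ?_⟩⟩
  · obtain ⟨g, hg, rfl⟩ := exists_isAdmissibleDensity hπ hkl
    rw [ofDensity, withDensity_apply _ hN, lintegral_eq_zero_iff hg.1.measurable.ennreal_ofReal]
    refine (ae_restrict_iff' hN).2 ?_
    filter_upwards [hf.ae_eq_zero hg] with x hx h0
    simp [hx h0]
  · exact (hf.1.1.integrable.integrableOn.const_mul (Real.exp (-c))).congr
      (by filter_upwards [hres] with x hx using hx.symm)
  · have hkl : klDiv π μ < ∞ := by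
      refine (hπ.2 _ hf.1.mem_admissible).trans_lt ?_
      rw [hf.1.1.klDiv_eq]
      exact ENNReal.ofReal_lt_top
    obtain ⟨g, hg, rfl⟩ := hπ.exists_isMinimalDensity hkl
    rw [hgibbs]
    refine withDensity_congr_ae ?_
    filter_upwards [hg.ae_eq hf] with x hx
    rw [hx]
  · rintro rfl
    rw [hgibbs]
    exact hf.isPrimalSolution

end Minimal

end MaxEnt

/-! ### Lagrangian duality. -/

namespace MaxEnt

section Duality

variable {d p : ℕ} {μ : Measure (EuclideanSpace ℝ (Fin d))}
  {F : EuclideanSpace ℝ (Fin d) → EuclideanSpace ℝ (Fin p)} {α : ℝ}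

theorem gibbs_eq_gibbsOff [IsProbabilityMeasure μ] {θ : EuclideanSpace ℝ (Fin p)}
    {N : Set (EuclideanSpace ℝ (Fin d))}
    (hN : μ N = 0) (hθ : θ ∈ parameterSet μ F) : gibbs μ F θ = gibbsOff μ F θ N := by
  have hae : ∀ᵐ x ∂μ, x ∈ Nᶜ := measure_eq_zero_iff_ae_notMem.1 hN
  refine withDensity_congr_ae ?_
  filter_upwards [hae] with x hx
  rw [Set.indicator_of_mem hx, Measure.restrict_eq_self_of_ae_mem hae, logPartition, Real.exp_sub,
    Real.exp_log (integral_exp_pos hθ)]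

/-- Among all measures of finite relative entropy, a minimal density of exponential form minimizes
the Lagrangian. -/
theorem IsAdmissibleDensity.entropy_le_add_inner {f g : EuclideanSpace ℝ (Fin d) → ℝ}
    (hf : IsAdmissibleDensity μ F α f) {θ : EuclideanSpace ℝ (Fin p)} {c : ℝ}
    (hfexp : ∀ᵐ x ∂μ, f x = Real.exp (-(inner ℝ θ (F x)) - c)) (hg : IsEntropyDensity μ F α g) :
    entropy μ f ≤ entropy μ g + inner ℝ θ (∫ x, g x • F x ∂μ) := by
  have hI := (hg.integrable_klFun.add (hg.integrable_features.const_inner θ)).add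
    (hg.integrable.const_mul c)
  have hJ := (hf.1.integrable_klFun.add (hf.1.integrable_features.const_inner θ)).add
    (hf.1.integrable.const_mul c)
  have h := integral_mono_ae hJ hI (by
    filter_upwards [hfexp] with x hx
    -- The tangent at `f x` has slope `-⟨θ, F x⟩ - c`. After integration the `c` terms cancel
    -- because both masses are one.
    have h1 := klFun_add_log_mul_le (m := f x) (hg.nonneg x) (hx ▸ Real.exp_pos _)
    rw [show Real.log (f x) = -(inner ℝ θ (F x)) - c by rw [hx, Real.log_exp]] at h1
    simp only [Pi.add_apply, inner_smul_right]
    linarith)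
  rw [integral_add' (hg.integrable_klFun.add (hg.integrable_features.const_inner θ))
    (hg.integrable.const_mul c),
    integral_add' hg.integrable_klFun (hg.integrable_features.const_inner θ),
    integral_add' (hf.1.integrable_klFun.add (hf.1.integrable_features.const_inner θ))
    (hf.1.integrable.const_mul c),
    integral_add' hf.1.integrable_klFun (hf.1.integrable_features.const_inner θ),
    integral_const_mul, integral_const_mul, hf.1.integral_eq_one, hg.integral_eq_one,
    integral_inner hg.integrable_features, integral_inner hf.1.integrable_features, hf.2,
    inner_zero_right] at h
  simp only [entropy]
  linarith

/-- Weak duality: the multiplier term vanishes at the feasible measure `π`. -/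
theorem IsPrimalSolution.dualFunction_le {π : Measure (EuclideanSpace ℝ (Fin d))}
    (hπ : IsPrimalSolution μ F α π) (θ : EuclideanSpace ℝ (Fin p)) :
    dualFunction μ F α θ ≤ (primalValue μ F α : EReal) := by
  refine (iInf₂_le π hπ.1.1).trans ?_
  rw [hπ.1.2.2, inner_zero_right, hπ.klDiv_eq_primalValue]
  simp

theorem primalValue_le_dualFunction [IsProbabilityMeasure μ] (hA1 : A1 F α)
    {θ : EuclideanSpace ℝ (Fin p)}
    (hπ : IsPrimalSolution μ F α (gibbs μ F θ)) (hfin : primalValue μ F α < ∞) :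
    (primalValue μ F α : EReal) ≤ dualFunction μ F α θ := by
  have hkl := hπ.klDiv_eq_primalValue
  obtain ⟨f, hf, hgf⟩ := hπ.exists_isMinimalDensity (hkl ▸ hfin)
  have hFm : Measurable fun x =>
      ENNReal.ofReal (Real.exp (-(inner ℝ θ (F x)) - logPartition μ F θ)) := by
    have : Continuous fun x => inner ℝ θ (F x) := continuous_const.inner hA1.1
    exact (Continuous.measurable (by fun_prop)).ennreal_ofReal
  have hfexp : ∀ᵐ x ∂μ, f x = Real.exp (-(inner ℝ θ (F x)) - logPartition μ F θ) := by
    have h1 : (fun x => ENNReal.ofReal (f x)) =ᵐ[μ]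
        fun x => ENNReal.ofReal (Real.exp (-(inner ℝ θ (F x)) - logPartition μ F θ)) := by
      refine (withDensity_eq_iff hf.1.1.measurable.ennreal_ofReal.aemeasurable hFm.aemeasurable
        hf.1.1.integrable.lintegral_lt_top.ne).1 hgf.symm
    filter_upwards [h1] with x hx
    rwa [ENNReal.ofReal_eq_ofReal_iff (hf.1.1.nonneg x) (Real.exp_pos _).le] at hx
  refine le_iInf₂ fun π hπ' => ?_
  rcases eq_top_or_lt_top (klDiv π μ) with h | h
  · rw [h, EReal.coe_ennreal_top, EReal.top_add_coe]
    exact le_top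
  obtain ⟨g, hg, rfl⟩ := exists_isEntropyDensity (F := F) hπ' (hA1.integrable hπ') h
  rw [← hkl, hgf, hf.1.1.klDiv_eq, hg.klDiv_eq, EReal.coe_ennreal_ofReal, EReal.coe_ennreal_ofReal,
    max_eq_left hf.1.1.entropy_nonneg, max_eq_left hg.entropy_nonneg, ← EReal.coe_add,
    integral_ofDensity hg.measurable hg.nonneg]
  exact EReal.coe_le_coe_iff.2 (hf.1.entropy_le_add_inner hfexp hg)

/-- The dominating measure gives `N` mass zero, hence so does `μ`. The integral off `N` is then the
full one, which puts `θ` in the parameter set. -/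
theorem SolutionIsGibbs.strong_duality [IsProbabilityMeasure μ] (hA1 : A1 F α)
    {θ : EuclideanSpace ℝ (Fin p)}
    {N : Set (EuclideanSpace ℝ (Fin d))} (h : SolutionIsGibbs μ F α θ N)
    (hfin : primalValue μ F α < ∞)
    (hπ : ∃ π ∈ admissible F α, klDiv π μ < ∞ ∧ μ ≪ π) :
    IsDualSolution μ F α θ ∧ IsPrimalSolution μ F α (gibbs μ F θ) ∧
      dualValue μ F α = (primalValue μ F α : EReal) := by
  obtain ⟨π, hπ, hkl, hac⟩ := hπ
  obtain ⟨-, hnull, hint, hsol⟩ := h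
  have hN : μ N = 0 := hac (hnull π hπ hkl)
  have hθ : θ ∈ parameterSet μ F := by
    have : ∀ᵐ x ∂μ, x ∈ Nᶜ := measure_eq_zero_iff_ae_notMem.1 hN
    rwa [IntegrableOn, Measure.restrict_eq_self_of_ae_mem this] at hint
  have hg : IsPrimalSolution μ F α (gibbs μ F θ) := (hsol _).2 (gibbs_eq_gibbsOff hN hθ)
  have hle := primalValue_le_dualFunction hA1 hg hfin
  exact ⟨⟨hθ, fun θ' _ => (hg.dualFunction_le θ').trans hle⟩, hg,
    le_antisymm (iSup₂_le fun θ' _ => hg.dualFunction_le θ')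
      (hle.trans (le_iSup₂_of_le θ hθ le_rfl))⟩

end Duality

end MaxEnt

/-! ### Limits of densities in `L¹`. -/

section Limits

variable {X : Type*} [MeasurableSpace X] {μ : Measure X}

/-- A rapidly Cauchy sequence of nonnegative functions in `L¹` has a nonnegative limit, which is an
almost everywhere limit along a subsequence. -/
theorem exists_tendsto_integral_abs_sub {f : ℕ → X → ℝ} (h0 : ∀ n x, 0 ≤ f n x)
    (hf : ∀ n, Integrable (f n) μ)
    (hc : ∀ N n m, N ≤ n → N ≤ m → ∫ x, |f n x - f m x| ∂μ ≤ 1 / 2 * (1 / 2) ^ N) :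
    ∃ g : X → ℝ, Measurable g ∧ (∀ x, 0 ≤ g x) ∧ Integrable g μ ∧
      Tendsto (fun n => ∫ x, |f n x - g x| ∂μ) atTop (𝓝 0) ∧
      ∃ ns : ℕ → ℕ, StrictMono ns ∧ ∀ᵐ x ∂μ, Tendsto (fun n => f (ns n) x) atTop (𝓝 (g x)) := by
  have heq : ∀ u v : X → ℝ, Integrable u μ → Integrable v μ →
      eLpNorm (u - v) 1 μ = ENNReal.ofReal (∫ x, |u x - v x| ∂μ) := by
    intro u v hu hv
    rw [eLpNorm_one_eq_lintegral_enorm, ← ofReal_integral_norm_eq_lintegral_enorm (hu.sub hv)]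
    rfl
  obtain ⟨g₀, hg₀, hlim⟩ := Lp.cauchy_complete_eLpNorm (μ := μ) (p := 1) le_rfl
    (fun n => memLp_one_iff_integrable.2 (hf n)) (B := fun n => ENNReal.ofReal ((1 / 2) ^ n))
    (summable_geometric_two.tsum_ofReal_ne_top) (fun N n m hn hm => by
      rw [heq _ _ (hf n) (hf m)]
      refine (ENNReal.ofReal_lt_ofReal_iff (by positivity)).2 ((hc N n m hn hm).trans_lt ?_)
      have : (0 : ℝ) < (1 / 2) ^ N := by positivity
      linarith)
  obtain ⟨ns, hns, hae⟩ := (tendstoInMeasure_of_tendsto_eLpNorm one_ne_zero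
    (fun n => (hf n).aestronglyMeasurable) hg₀.aestronglyMeasurable hlim).exists_seq_tendsto_ae
  have hmeas := hg₀.aestronglyMeasurable.aemeasurable
  -- A measurable representative, truncated so as to be nonnegative everywhere and not just almost
  -- everywhere.
  set g : X → ℝ := fun x => max (hmeas.mk g₀ x) 0 with hg
  have hgg : g₀ =ᵐ[μ] g := by
    filter_upwards [hae, hmeas.ae_eq_mk] with x hx hx2
    rw [hg]
    simp only [← hx2]
    exact (max_eq_left (ge_of_tendsto' hx fun n => h0 _ x)).symm
  have hgi : Integrable g μ := (memLp_one_iff_integrable.1 hg₀).congr hgg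
  refine ⟨g, hmeas.measurable_mk.max measurable_const, fun x => le_max_right _ _, hgi, ?_, ns, hns,
    ?_⟩
  · have h1 : ∀ n, eLpNorm (f n - g₀) 1 μ = ENNReal.ofReal (∫ x, |f n x - g x| ∂μ) := by
      intro n
      rw [← heq _ _ (hf n) hgi]
      exact eLpNorm_congr_ae (by filter_upwards [hgg] with x hx; simp [hx])
    simp only [h1] at hlim
    have h2 := (ENNReal.tendsto_toReal ENNReal.zero_ne_top).comp hlim
    refine h2.congr fun n => ?_
    exact ENNReal.toReal_ofReal (integral_nonneg fun x => abs_nonneg _)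
  · filter_upwards [hae, hgg] with x hx hx2
    rwa [← hx2]

/-- Fatou's lemma for Bochner integrals. -/
theorem integrable_and_integral_le_of_tendsto {h : ℕ → X → ℝ} {k : X → ℝ} {b : ℕ → ℝ} {B : ℝ}
    (hm : ∀ n, Measurable (h n)) (hk : Measurable k) (h0 : ∀ n x, 0 ≤ h n x) (hk0 : ∀ x, 0 ≤ k x)
    (hi : ∀ n, Integrable (h n) μ) (hb : ∀ n, ∫ x, h n x ∂μ ≤ b n) (hB : Tendsto b atTop (𝓝 B))
    (hlim : ∀ᵐ x ∂μ, Tendsto (fun n => h n x) atTop (𝓝 (k x))) :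
    Integrable k μ ∧ ∫ x, k x ∂μ ≤ B := by
  have hB0 : 0 ≤ B := ge_of_tendsto' hB fun n => (integral_nonneg (h0 n)).trans (hb n)
  have h1 : ∫⁻ x, ENNReal.ofReal (k x) ∂μ ≤ ENNReal.ofReal B := by
    calc ∫⁻ x, ENNReal.ofReal (k x) ∂μ
        = ∫⁻ x, liminf (fun n => ENNReal.ofReal (h n x)) atTop ∂μ := by
          refine lintegral_congr_ae ?_
          filter_upwards [hlim] with x hx
          exact ((ENNReal.continuous_ofReal.tendsto _).comp hx).liminf_eq.symm
      _ ≤ liminf (fun n => ∫⁻ x, ENNReal.ofReal (h n x) ∂μ) atTop :=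
          lintegral_liminf_le fun n => (hm n).ennreal_ofReal
      _ ≤ liminf (fun n => ENNReal.ofReal (b n)) atTop := by
          refine liminf_le_liminf (Eventually.of_forall fun n => ?_)
          rw [← ofReal_integral_eq_lintegral_ofReal (hi n) (ae_of_all _ (h0 n))]
          exact ENNReal.ofReal_le_ofReal (hb n)
      _ = ENNReal.ofReal B := ((ENNReal.continuous_ofReal.tendsto _).comp hB).liminf_eq
  have hki : Integrable k μ :=
    (lintegral_ofReal_ne_top_iff_integrable hk.aestronglyMeasurable (ae_of_all _ hk0)).1
      (h1.trans_lt ENNReal.ofReal_lt_top).ne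
  refine ⟨hki, ?_⟩
  rwa [← ofReal_integral_eq_lintegral_ofReal hki (ae_of_all _ hk0),
    ENNReal.ofReal_le_ofReal_iff hB0] at h1

variable {E : Type*} [NormedAddCommGroup E] [NormedSpace ℝ E]

theorem integrable_smul_of_norm_le {W f : X → ℝ} {H : X → E} {K ε : ℝ} (hf0 : ∀ x, 0 ≤ f x)
    (hf : Integrable f μ) (hfW : Integrable (fun x => f x * W x) μ)
    (hH : AEStronglyMeasurable H μ) (hHW : ∀ x, ‖H x‖ ≤ K + ε * W x) :
    Integrable (fun x => f x • H x) μ := by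
  refine ((hf.const_mul K).add (hfW.const_mul ε)).mono' (hf.aestronglyMeasurable.smul hH)
    (ae_of_all _ fun x => ?_)
  rw [norm_smul, Real.norm_of_nonneg (hf0 x)]
  have := mul_le_mul_of_nonneg_left (hHW x) (hf0 x)
  simp only [Pi.add_apply]
  linarith

/-- If `f n → g` in `L¹`, the integrals of `f n` and `g` against a weight `W` are bounded and `H` is
negligible compared to `W`, then the integrals of `H` against `f n` converge. -/
theorem tendsto_integral_smul_of_norm_le {f : ℕ → X → ℝ} {g W : X → ℝ} {H : X → E} {M : ℝ}
    (hf0 : ∀ n x, 0 ≤ f n x) (hg0 : ∀ x, 0 ≤ g x) (hW0 : ∀ x, 0 ≤ W x)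
    (hf : ∀ n, Integrable (f n) μ) (hg : Integrable g μ)
    (hfW : ∀ n, Integrable (fun x => f n x * W x) μ) (hgW : Integrable (fun x => g x * W x) μ)
    (hfM : ∀ n, ∫ x, f n x * W x ∂μ ≤ M) (hgM : ∫ x, g x * W x ∂μ ≤ M)
    (hH : AEStronglyMeasurable H μ) (hHW : ∀ ε : ℝ, 0 < ε → ∃ K, ∀ x, ‖H x‖ ≤ K + ε * W x)
    (hlim : Tendsto (fun n => ∫ x, |f n x - g x| ∂μ) atTop (𝓝 0)) :
    Tendsto (fun n => ∫ x, f n x • H x ∂μ) atTop (𝓝 (∫ x, g x • H x ∂μ)) := by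
  have hM : 0 ≤ M := (integral_nonneg fun x => mul_nonneg (hg0 x) (hW0 x)).trans hgM
  rw [Metric.tendsto_atTop]
  intro ε hε
  -- The two weighted integrals total at most `2 * M`; the extra `1` keeps the denominator positive
  -- and the final bound strict.
  set e := ε / (2 * (2 * M + 1)) with he
  have he0 : 0 < e := by positivity
  obtain ⟨K, hK⟩ := hHW e he0
  have hlim2 := (hlim.const_mul K)
  rw [mul_zero] at hlim2
  obtain ⟨N, hN⟩ := eventually_atTop.1 (hlim2.eventually_lt_const (half_pos hε))
  refine ⟨N, fun n hn => ?_⟩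
  have hfH := integrable_smul_of_norm_le (hf0 n) (hf n) (hfW n) hH hK
  have hgH := integrable_smul_of_norm_le hg0 hg hgW hH hK
  have hD : Integrable (fun x => |f n x - g x|) μ := ((hf n).sub hg).abs
  rw [dist_eq_norm, ← integral_sub hfH hgH]
  calc ‖∫ x, (f n x • H x - g x • H x) ∂μ‖
      ≤ ∫ x, (K * |f n x - g x| + e * (f n x * W x + g x * W x)) ∂μ := by
        refine norm_integral_le_of_norm_le
          ((hD.const_mul K).add (((hfW n).add hgW).const_mul e)) (ae_of_all _ fun x => ?_)
        rw [← sub_smul, norm_smul, Real.norm_eq_abs]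
        have h1 := mul_le_mul_of_nonneg_left (hK x) (abs_nonneg (f n x - g x))
        have h2 : |f n x - g x| ≤ f n x + g x := by
          rw [abs_le]
          constructor <;> linarith [hf0 n x, hg0 x]
        have h3 := mul_le_mul_of_nonneg_right h2 (mul_nonneg he0.le (hW0 x))
        linarith
    _ = K * ∫ x, |f n x - g x| ∂μ + e * (∫ x, f n x * W x ∂μ + ∫ x, g x * W x ∂μ) := by
        rw [← integral_add (hfW n) hgW, ← integral_const_mul, ← integral_const_mul]
        exact integral_add (hD.const_mul K) (((hfW n).add hgW).const_mul e)
    _ < ε / 2 + ε / 2 := by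
        refine add_lt_add (hN n hn) ?_
        have h1 : e * (2 * M + 1) = ε / 2 := by rw [he]; field_simp
        nlinarith [hfM n]
    _ = ε := add_halves ε

theorem rpow_le_add_mul_rpow {α β : ℝ} (hα : 0 ≤ α) (hαβ : α < β) {ε : ℝ} (hε : 0 < ε) :
    ∃ K, 0 ≤ K ∧ ∀ r : ℝ, 0 ≤ r → r ^ α ≤ K + ε * r ^ β := by
  -- The crossover radius, where `R ^ α = ε * R ^ β`.
  set R : ℝ := (1 / ε) ^ (β - α)⁻¹ with hR
  have hR0 : 0 < R := by positivity
  refine ⟨R ^ α, by positivity, fun r hr => ?_⟩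
  rcases le_total r R with h | h
  · have := Real.rpow_le_rpow hr h hα
    have : 0 ≤ ε * r ^ β := by positivity
    linarith
  · have hr0 : 0 < r := hR0.trans_le h
    have h1 : 1 / ε ≤ r ^ (β - α) := by
      rw [← Real.rpow_inv_rpow (one_div_pos.2 hε).le (sub_pos.2 hαβ).ne']
      exact Real.rpow_le_rpow hR0.le h (sub_pos.2 hαβ).le
    have h2 : r ^ β = r ^ α * r ^ (β - α) := by rw [← Real.rpow_add hr0]; ring_nf
    have h3 : 0 < R ^ α := by positivity
    have h4 : 1 ≤ ε * r ^ (β - α) := by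
      rw [div_le_iff₀ hε] at h1
      linarith
    have h5 := mul_le_mul_of_nonneg_left h4 (Real.rpow_nonneg hr α)
    rw [h2]
    linarith

end Limits

/-! ### Existence by the direct method. -/

namespace MaxEnt

section Existence

variable {d p : ℕ} {μ : Measure (EuclideanSpace ℝ (Fin d))}
  {F : EuclideanSpace ℝ (Fin d) → EuclideanSpace ℝ (Fin p)} {α : ℝ}

/-- Young's inequality with `y = η * W x`: entropy and an exponential moment together control the
integral of `W`. -/
theorem IsEntropyDensity.integrable_mul_and_integral_le {f W : EuclideanSpace ℝ (Fin d) → ℝ}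
    (hf : IsEntropyDensity μ F α f) (hW : Measurable W) (hW0 : ∀ x, 0 ≤ W x) {η : ℝ} (hη : 0 < η)
    (hexp : Integrable (fun x => Real.exp (η * W x)) μ) :
    Integrable (fun x => f x * W x) μ ∧
      ∫ x, f x * W x ∂μ ≤ (entropy μ f + ∫ x, Real.exp (η * W x) ∂μ) / η := by
  have hI := (hf.integrable_klFun.add hexp).div_const η
  have hle : ∀ x, f x * W x ≤ (klFun (f x) + Real.exp (η * W x)) / η := by
    intro x
    rw [le_div_iff₀ hη]
    linarith [mul_le_klFun_sub_one_add_exp (hf.nonneg x) (η * W x)]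
  have hfW : Integrable (fun x => f x * W x) μ := by
    refine hI.mono' (hf.measurable.mul hW).aestronglyMeasurable (ae_of_all _ fun x => ?_)
    rw [Real.norm_of_nonneg (mul_nonneg (hf.nonneg x) (hW0 x))]
    exact hle x
  refine ⟨hfW, ?_⟩
  rw [entropy, ← integral_add hf.integrable_klFun hexp, ← integral_div]
  exact integral_mono hfW hI hle

/-- Under an exponential moment of order larger than `α`, the relative entropy attains its minimum
over admissible densities. -/
theorem exists_isMinimalDensity_of_exp_moment [IsProbabilityMeasure μ] (hα : 0 ≤ α)
    (hA1 : A1 F α) {β : ℝ} (hβ : α < β) (hA2 : A2 μ β) (hne : ∃ f, IsAdmissibleDensity μ F α f) :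
    ∃ f, IsMinimalDensity μ F α f := by
  obtain ⟨η, hη, hexp⟩ := hA2
  set W : EuclideanSpace ℝ (Fin d) → ℝ := fun x => ‖x‖ ^ β with hWdef
  have hW : Measurable W := (measurable_norm.pow_const β)
  have hW0 : ∀ x, 0 ≤ W x := fun x => Real.rpow_nonneg (norm_nonneg x) β
  set S : Set ℝ := entropy μ '' {f | IsAdmissibleDensity μ F α f} with hS
  have hSne : S.Nonempty := by
    obtain ⟨f, hf⟩ := hne
    exact ⟨_, f, hf, rfl⟩
  have hSbdd : BddBelow S := by
    refine ⟨0, ?_⟩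
    rintro _ ⟨f, hf, rfl⟩
    exact hf.1.entropy_nonneg
  set V := sInf S with hVdef
  have hV : ∀ f, IsAdmissibleDensity μ F α f → V ≤ entropy μ f := fun f hf =>
    csInf_le hSbdd ⟨f, hf, rfl⟩
  -- With the factor `1 / 8`, the `L¹` bound `4 * δ N` is the rate required by
  -- `exists_tendsto_integral_abs_sub`.
  set δ : ℕ → ℝ := fun n => 1 / 8 * (1 / 2) ^ n with hδ
  have hδ0 : ∀ n, 0 < δ n := fun n => by positivity
  have hδle : ∀ N n, N ≤ n → δ n ≤ δ N := fun N n h =>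
    mul_le_mul_of_nonneg_left (pow_le_pow_of_le_one (by norm_num) (by norm_num) h) (by norm_num)
  have hex : ∀ n, ∃ f, IsAdmissibleDensity μ F α f ∧ entropy μ f ≤ V + δ n ^ 2 := by
    intro n
    obtain ⟨_, ⟨f, hf, rfl⟩, hlt⟩ := exists_lt_of_csInf_lt hSne
      (lt_add_of_pos_right V (pow_pos (hδ0 n) 2))
    exact ⟨f, hf, hlt.le⟩
  choose f hf hfV using hex
  have hfV' : ∀ N n, N ≤ n → entropy μ (f n) ≤ V + δ N ^ 2 := fun N n h =>
    (hfV n).trans (add_le_add le_rfl (pow_le_pow_left₀ (hδ0 n).le (hδle N n h) 2))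
  obtain ⟨g, hgm, hg0, hgi, hlim, ns, hns, hae⟩ := exists_tendsto_integral_abs_sub
    (fun n => (hf n).1.nonneg) (fun n => (hf n).1.integrable) (fun N n m hn hm =>
      (integral_abs_sub_le_of_entropy_le (hf n) (hf m) (hδ0 N) hV (hfV' N n hn)
        (hfV' N m hm)).trans (by rw [hδ]; linarith))
  have hδlim : Tendsto (fun n => V + δ (ns n) ^ 2) atTop (𝓝 V) := by
    have h1 : Tendsto δ atTop (𝓝 0) := by
      have := (tendsto_pow_atTop_nhds_zero_of_lt_one (r := (1 / 2 : ℝ)) (by norm_num)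
        (by norm_num)).const_mul (1 / 8)
      rwa [mul_zero] at this
    have h2 := ((h1.comp hns.tendsto_atTop).pow 2).const_add V
    simpa using h2
  obtain ⟨hgkl, hgV⟩ := integrable_and_integral_le_of_tendsto
    (fun n => measurable_klFun.comp (hf (ns n)).1.measurable) (measurable_klFun.comp hgm)
    (fun n x => klFun_nonneg ((hf (ns n)).1.nonneg x)) (fun x => klFun_nonneg (hg0 x))
    (fun n => (hf (ns n)).1.integrable_klFun) (fun n => hfV (ns n)) hδlim (by
      filter_upwards [hae] with x hx
      exact (continuous_klFun.tendsto _).comp hx)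
  set M := (V + δ 0 ^ 2 + ∫ x, Real.exp (η * W x) ∂μ) / η with hM
  have hfW := fun n => ((hf n).1.integrable_mul_and_integral_le hW hW0 hη hexp).1
  have hfM : ∀ n, ∫ x, f n x * W x ∂μ ≤ M := fun n =>
    ((hf n).1.integrable_mul_and_integral_le hW hW0 hη hexp).2.trans
      (div_le_div_of_nonneg_right (add_le_add (hfV' 0 n n.zero_le) le_rfl) hη.le)
  obtain ⟨hgW, hgM⟩ := integrable_and_integral_le_of_tendsto
    (fun n => (hf (ns n)).1.measurable.mul hW) (hgm.mul hW)
    (fun n x => mul_nonneg ((hf (ns n)).1.nonneg x) (hW0 x)) (fun x => mul_nonneg (hg0 x) (hW0 x))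
    (fun n => hfW (ns n)) (fun n => hfM (ns n)) tendsto_const_nhds (by
      filter_upwards [hae] with x hx
      exact hx.mul_const (W x))
  -- Stated for a general target so as to serve both the scalar mass constraint and the vector
  -- feature constraint.
  have hconv : ∀ {E : Type} [NormedAddCommGroup E] [NormedSpace ℝ E]
      {H : EuclideanSpace ℝ (Fin d) → E}, AEStronglyMeasurable H μ →
      (∀ ε : ℝ, 0 < ε → ∃ K, ∀ x, ‖H x‖ ≤ K + ε * W x) →
      Tendsto (fun n => ∫ x, f n x • H x ∂μ) atTop (𝓝 (∫ x, g x • H x ∂μ)) :=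
    fun hH hHW => tendsto_integral_smul_of_norm_le (fun n => (hf n).1.nonneg) hg0 hW0
      (fun n => (hf n).1.integrable) hgi hfW hgW hfM hgM hH hHW hlim
  have hpow : ∀ ε : ℝ, 0 < ε → ∃ K, 0 ≤ K ∧ ∀ x : EuclideanSpace ℝ (Fin d),
      ‖x‖ ^ α ≤ K + ε * W x := fun ε hε => by
    obtain ⟨K, hK0, hK⟩ := rpow_le_add_mul_rpow hα hβ hε
    exact ⟨K, hK0, fun x => hK _ (norm_nonneg x)⟩
  have hFW : ∀ ε : ℝ, 0 < ε → ∃ K, ∀ x, ‖F x‖ ≤ K + ε * W x := by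
    intro ε hε
    obtain ⟨C, hC0, hC⟩ := hA1.norm_le
    obtain ⟨K, -, hK⟩ := hpow (ε / (C + 1)) (by positivity)
    refine ⟨C * (1 + K), fun x => (hC x).trans ?_⟩
    have h1 := mul_le_mul_of_nonneg_left (hK x) hC0
    have h2 : C * (ε / (C + 1) * W x) ≤ ε * W x := by
      rw [← mul_assoc]
      refine mul_le_mul_of_nonneg_right ?_ (hW0 x)
      rw [mul_div_assoc', div_le_iff₀ (by positivity)]
      nlinarith
    linarith
  have hFm : AEStronglyMeasurable F μ := hA1.1.aestronglyMeasurable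
  have hmass : ∫ x, g x ∂μ = 1 := by
    have h1 := hconv (H := fun _ => (1 : ℝ)) aestronglyMeasurable_const fun ε hε =>
      ⟨1, fun x => by
        rw [norm_one]
        linarith [mul_nonneg hε.le (hW0 x)]⟩
    simp only [smul_eq_mul, mul_one, (hf _).1.integral_eq_one] at h1
    exact (tendsto_nhds_unique h1 tendsto_const_nhds)
  have hzero : ∫ x, g x • F x ∂μ = 0 := by
    have h1 := hconv hFm hFW
    simp only [(hf _).2] at h1
    exact (tendsto_nhds_unique h1 tendsto_const_nhds)
  obtain ⟨K, -, hK⟩ := hpow 1 one_pos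
  obtain ⟨K', hK'⟩ := hFW 1 one_pos
  refine ⟨g, ⟨⟨hgm, hg0, hgi, hmass, ?_, ?_, hgkl⟩, hzero⟩, fun h hh => hgV.trans (hV h hh)⟩
  · refine integrable_smul_of_norm_le (ε := 1) (K := K) hg0 hgi hgW
      (measurable_norm.pow_const α).aestronglyMeasurable fun x => ?_
    rw [Real.norm_of_nonneg (Real.rpow_nonneg (norm_nonneg x) α)]
    exact hK x
  · exact integrable_smul_of_norm_le hg0 hgi hgW hFm hK'

end Existence

end MaxEnt

/-! ### Assembly of (a) and (b). -/

theorem proposition3 (d p : ℕ) (μ : Measure (EuclideanSpace ℝ (Fin d))) [IsProbabilityMeasure μ]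
    (F : EuclideanSpace ℝ (Fin d) → EuclideanSpace ℝ (Fin p)) (α : ℝ) (hα : 0 ≤ α)
    (hA1 : MaxEnt.A1 F α) :
    -- (a)
    ((∃ π, MaxEnt.IsPrimalSolution μ F α π) → MaxEnt.primalValue μ F α < ∞ →
      (∃ θ N, MaxEnt.SolutionIsGibbs μ F α θ N) ∧
      ((∃ π ∈ MaxEnt.admissible F α, klDiv π μ < ∞ ∧ μ ≪ π) →
        ∀ θ N, MaxEnt.SolutionIsGibbs μ F α θ N →
          MaxEnt.IsDualSolution μ F α θ ∧
          MaxEnt.IsPrimalSolution μ F α (MaxEnt.gibbs μ F θ) ∧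
          MaxEnt.dualValue μ F α = (MaxEnt.primalValue μ F α : EReal))) ∧
    -- (b)
    (∀ α' : ℝ, α < α' → MaxEnt.A2 μ α' →
      (((∃ θ N, MaxEnt.SolutionIsGibbs μ F α θ N) ∧ MaxEnt.primalValue μ F α < ∞) ↔
        ∃ π ∈ MaxEnt.admissible F α, klDiv π μ < ∞)) := by
  refine ⟨fun ⟨π, hπ⟩ hfin => ⟨?_, fun hπ' θ N h => h.strong_duality hA1 hfin hπ'⟩,
    fun α' hα' hA2 => ⟨?_, ?_⟩⟩
  · obtain ⟨f, hf, -⟩ := hπ.exists_isMinimalDensity (hπ.klDiv_eq_primalValue ▸ hfin)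
    exact hf.exists_solutionIsGibbs
  · rintro ⟨⟨θ, N, -, -, -, hsol⟩, hfin⟩
    have hπ := (hsol _).2 rfl
    exact ⟨_, hπ.1, hπ.klDiv_eq_primalValue ▸ hfin⟩
  · rintro ⟨π, hπ, hkl⟩
    obtain ⟨f₀, hf₀, -⟩ := MaxEnt.exists_isAdmissibleDensity hπ hkl
    obtain ⟨f, hf⟩ := MaxEnt.exists_isMinimalDensity_of_exp_moment hα hA1 hα' hA2 ⟨f₀, hf₀⟩
    exact ⟨hf.exists_solutionIsGibbs, (iInf₂_le π hπ).trans_lt hkl⟩
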